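/- Let $R$ be a prime ring (associative, not necessarily with unity; $aRb=0$ implies $a=0$ or $b=0$) with center $Z(R)$. Let $Q_s(R)$ be its Martindale symmetric ring of quotients and let $C$, the extended centroid, be the center of $Q_s(R)$. Write $[x,y]=xy-yx$. For an additive subgroup $A$ of $R$ let $AC$ be the additive subgroup of $Q_s(R)$ generated by all $ac$ with $a\in A$, $c\in C$, and let $[RC,RC]$ be the additive subgroup generated by all $[x,y]$ with $x,y\in RC$. Assume that $R$ is exceptional, that is, $\operatorname{char} R=2$ and $\dim_C RC=4$. Let $L$ be a noncentral Lie ideal of $R$ (an additive subgroup with $[L,R]\subseteq L$ and $L\not\subseteq Z(R)$), let $n\ge 1$ and $a_1,\dots,a_n\in R$, and put $[a_1,\dots,a_n,L]=[a_1,[a_2,[\cdots,[a_n,L]\cdots]]]$. (i) If either $L$ is abelian ($[L,L]=0$), or $L$ is nonabelian of Type I (that is, $[L,L]\neq 0$ and $LC=[RC,RC]$), then $[a_1,\dots,a_n,L]\subseteq Z(R)$ if and only if at least one of $a_1,\dots,a_n$ lies in $[RC,RC]$. (ii) If $L$ is nonabelian of Type II (that is, $[L,L]\neq 0$ and $LC=RC$),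 then $[a_1,\dots,a_n,L]\subseteq Z(R)$ if and only if $a_n\in Z(R)$ or at least one of $a_1,\dots,a_{n-1}$ lies in $[RC,RC]$. -/

import Mathlib

/-- A (not necessarily unital) ring is prime if `a R b = 0` implies `a = 0` or `b = 0`. -/
class IsPrimeRing (R : Type*) [NonUnitalRing R] : Prop where
  eq_zero_or_eq_zero : ∀ a b : R, (∀ x : R, a * x * b = 0) → a = 0 ∨ b = 0

namespace Martindale

section Construction

variable {R : Type*} [NonUnitalRing R]

/-- A balanced pair of module maps on a nonzero two-sided ideal `I` of `R`: the map `f` restricts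
to a homomorphism `I → R` of right `R`-modules (`x ↦ q x`), the map `g` restricts to a homomorphism
`I → R` of left `R`-modules (`x ↦ x q`), and `x (q y) = (x q) y`. Only the values on `I` matter. -/
structure Pre (R : Type*) [NonUnitalRing R] where
  I : TwoSidedIdeal R
  ne_bot : I ≠ ⊥
  f : R → R
  g : R → R
  f_add : ∀ x ∈ I, ∀ y ∈ I, f (x + y) = f x + f y
  f_mul : ∀ x ∈ I, ∀ r : R, f (x * r) = f x * r
  g_add : ∀ x ∈ I, ∀ y ∈ I, g (x + y) = g x + g y
  g_mul : ∀ x ∈ I, ∀ r : R, g (r * x) = r * g x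
  balanced : ∀ x ∈ I, ∀ y ∈ I, x * f y = g x * y

theorem exists_mem_ne_zero {I : TwoSidedIdeal R} (h : I ≠ ⊥) : ∃ x ∈ I, x ≠ 0 := by
  by_contra! H
  exact h (eq_bot_iff.2 fun x hx => (TwoSidedIdeal.mem_bot R).2 (H x hx))

theorem ne_bot_of_mem {I : TwoSidedIdeal R} {x : R} (h : x ∈ I) (hx : x ≠ 0) : I ≠ ⊥ := by
  rintro rfl
  exact hx ((TwoSidedIdeal.mem_bot R).1 h)

theorem exists_mul_ne_zero [IsPrimeRing R] {a b : R} (ha : a ≠ 0) (hb : b ≠ 0) :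
    ∃ x : R, a * x * b ≠ 0 := by
  by_contra! H
  rcases IsPrimeRing.eq_zero_or_eq_zero a b H with h | h
  · exact ha h
  · exact hb h

theorem inf_ne_bot [IsPrimeRing R] {I J : TwoSidedIdeal R} (hI : I ≠ ⊥) (hJ : J ≠ ⊥) :
    I ⊓ J ≠ ⊥ := by
  obtain ⟨a, ha, ha0⟩ := exists_mem_ne_zero hI
  obtain ⟨b, hb, hb0⟩ := exists_mem_ne_zero hJ
  obtain ⟨x, hx⟩ := exists_mul_ne_zero ha0 hb0
  exact ne_bot_of_mem ((TwoSidedIdeal.mem_inf _).2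
    ⟨I.mul_mem_right _ _ (I.mul_mem_right _ _ ha), J.mul_mem_left _ _ hb⟩) hx

theorem top_ne_bot [Nontrivial R] : (⊤ : TwoSidedIdeal R) ≠ ⊥ := by
  obtain ⟨x, hx⟩ := exists_ne (0 : R)
  exact ne_bot_of_mem (I := ⊤) trivial hx

namespace Pre

theorem f_zero (a : Pre R) : a.f 0 = 0 := by
  simpa using a.f_add 0 a.I.zero_mem 0 a.I.zero_mem

theorem g_zero (a : Pre R) : a.g 0 = 0 := by
  simpa using a.g_add 0 a.I.zero_mem 0 a.I.zero_mem

theorem f_neg (a : Pre R) {x : R} (hx : x ∈ a.I) : a.f (-x) = -a.f x := by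
  have h := a.f_add x hx (-x) (a.I.neg_mem hx)
  rw [add_neg_cancel, f_zero] at h
  exact (neg_eq_of_add_eq_zero_right h.symm).symm

theorem g_neg (a : Pre R) {x : R} (hx : x ∈ a.I) : a.g (-x) = -a.g x := by
  have h := a.g_add x hx (-x) (a.I.neg_mem hx)
  rw [add_neg_cancel, g_zero] at h
  exact (neg_eq_of_add_eq_zero_right h.symm).symm

/-- Two balanced pairs are identified if they agree on a nonzero ideal contained in both
domains. -/
def Rel (a b : Pre R) : Prop :=
  ∃ K : TwoSidedIdeal R, K ≠ ⊥ ∧ K ≤ a.I ∧ K ≤ b.I ∧ ∀ x ∈ K, a.f x = b.f x ∧ a.g x = b.g x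

instance setoid (R : Type*) [NonUnitalRing R] [IsPrimeRing R] : Setoid (Pre R) where
  r := Rel
  iseqv :=
    { refl := fun a => ⟨a.I, a.ne_bot, le_rfl, le_rfl, fun _ _ => ⟨rfl, rfl⟩⟩
      symm := fun ⟨K, h0, ha, hb, h⟩ =>
        ⟨K, h0, hb, ha, fun x hx => ⟨(h x hx).1.symm, (h x hx).2.symm⟩⟩
      trans := fun ⟨K, h0, ha, _, h⟩ ⟨M, h0', _, hc, h'⟩ =>
        ⟨K ⊓ M, inf_ne_bot h0 h0', inf_le_left.trans ha, inf_le_right.trans hc, fun x hx => by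
          obtain ⟨hK, hM⟩ := (TwoSidedIdeal.mem_inf _).1 hx
          exact ⟨(h x hK).1.trans (h' x hM).1, (h x hK).2.trans (h' x hM).2⟩⟩ }

/-- The pair of multiplication maps by an element `r` of `R`. -/
def ofRing [Nontrivial R] (r : R) : Pre R where
  I := ⊤
  ne_bot := top_ne_bot
  f x := r * x
  g x := x * r
  f_add _ _ _ _ := mul_add _ _ _
  f_mul _ _ _ := (mul_assoc _ _ _).symm
  g_add _ _ _ _ := add_mul _ _ _
  g_mul _ _ _ := mul_assoc _ _ _
  balanced _ _ _ _ := (mul_assoc _ _ _).symm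

def one [Nontrivial R] : Pre R where
  I := ⊤
  ne_bot := top_ne_bot
  f x := x
  g x := x
  f_add _ _ _ _ := rfl
  f_mul _ _ _ := rfl
  g_add _ _ _ _ := rfl
  g_mul _ _ _ := rfl
  balanced _ _ _ _ := rfl

def zero [Nontrivial R] : Pre R where
  I := ⊤
  ne_bot := top_ne_bot
  f _ := 0
  g _ := 0
  f_add _ _ _ _ := (add_zero _).symm
  f_mul _ _ _ := (zero_mul _).symm
  g_add _ _ _ _ := (add_zero _).symm
  g_mul _ _ _ := (mul_zero _).symm
  balanced _ _ _ _ := by simp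

def neg (a : Pre R) : Pre R where
  I := a.I
  ne_bot := a.ne_bot
  f x := -a.f x
  g x := -a.g x
  f_add x hx y hy := by rw [a.f_add x hx y hy, neg_add]
  f_mul x hx r := by rw [a.f_mul x hx r, neg_mul]
  g_add x hx y hy := by rw [a.g_add x hx y hy, neg_add]
  g_mul x hx r := by rw [a.g_mul x hx r, mul_neg]
  balanced x hx y hy := by rw [mul_neg, neg_mul, a.balanced x hx y hy]

def add [IsPrimeRing R] (a b : Pre R) : Pre R where
  I := a.I ⊓ b.I
  ne_bot := inf_ne_bot a.ne_bot b.ne_bot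
  f x := a.f x + b.f x
  g x := a.g x + b.g x
  f_add x hx y hy := by
    rw [TwoSidedIdeal.mem_inf] at hx hy
    rw [a.f_add x hx.1 y hy.1, b.f_add x hx.2 y hy.2]
    abel
  f_mul x hx r := by
    rw [TwoSidedIdeal.mem_inf] at hx
    rw [a.f_mul x hx.1 r, b.f_mul x hx.2 r, add_mul]
  g_add x hx y hy := by
    rw [TwoSidedIdeal.mem_inf] at hx hy
    rw [a.g_add x hx.1 y hy.1, b.g_add x hx.2 y hy.2]
    abel
  g_mul x hx r := by
    rw [TwoSidedIdeal.mem_inf] at hx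
    rw [a.g_mul x hx.1 r, b.g_mul x hx.2 r, mul_add]
  balanced x hx y hy := by
    rw [TwoSidedIdeal.mem_inf] at hx hy
    rw [mul_add, add_mul, a.balanced x hx.1 y hy.1, b.balanced x hx.2 y hy.2]

/-- For ideals `K`, `M` in the domains of `a` and `b`, an ideal contained in `K ⊓ M` that is sent
into `K` by `b.f` and into `M` by `a.g`. -/
def mulIdeal (a b : Pre R) (K M : TwoSidedIdeal R) (hK : K ≤ a.I) (hM : M ≤ b.I) :
    TwoSidedIdeal R :=
  TwoSidedIdeal.mk'
    {x | x ∈ K ∧ x ∈ M ∧ b.f x ∈ K ∧ a.g x ∈ M ∧ (∀ r, b.f (r * x) ∈ K) ∧ ∀ r, a.g (x * r) ∈ M}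
    (by
      refine ⟨K.zero_mem, M.zero_mem, ?_, ?_, fun r => ?_, fun r => ?_⟩
      · rw [f_zero]; exact K.zero_mem
      · rw [g_zero]; exact M.zero_mem
      · rw [mul_zero, f_zero]; exact K.zero_mem
      · rw [zero_mul, g_zero]; exact M.zero_mem)
    (by
      rintro x y ⟨h1, h2, h3, h4, h5, h6⟩ ⟨k1, k2, k3, k4, k5, k6⟩
      refine ⟨K.add_mem h1 k1, M.add_mem h2 k2, ?_, ?_, fun r => ?_, fun r => ?_⟩
      · rw [b.f_add x (hM h2) y (hM k2)]; exact K.add_mem h3 k3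
      · rw [a.g_add x (hK h1) y (hK k1)]; exact M.add_mem h4 k4
      · rw [mul_add, b.f_add _ (b.I.mul_mem_left _ _ (hM h2)) _ (b.I.mul_mem_left _ _ (hM k2))]
        exact K.add_mem (h5 r) (k5 r)
      · rw [add_mul, a.g_add _ (a.I.mul_mem_right _ _ (hK h1)) _ (a.I.mul_mem_right _ _ (hK k1))]
        exact M.add_mem (h6 r) (k6 r))
    (by
      rintro x ⟨h1, h2, h3, h4, h5, h6⟩
      refine ⟨K.neg_mem h1, M.neg_mem h2, ?_, ?_, fun r => ?_, fun r => ?_⟩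
      · rw [b.f_neg (hM h2)]; exact K.neg_mem h3
      · rw [a.g_neg (hK h1)]; exact M.neg_mem h4
      · rw [mul_neg, b.f_neg (b.I.mul_mem_left _ _ (hM h2))]; exact K.neg_mem (h5 r)
      · rw [neg_mul, a.g_neg (a.I.mul_mem_right _ _ (hK h1))]; exact M.neg_mem (h6 r))
    (by
      rintro s x ⟨h1, h2, h3, h4, h5, h6⟩
      refine ⟨K.mul_mem_left _ _ h1, M.mul_mem_left _ _ h2, h5 s, ?_, fun r => ?_, fun r => ?_⟩
      · rw [a.g_mul x (hK h1)]; exact M.mul_mem_left _ _ h4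
      · rw [← mul_assoc]; exact h5 _
      · rw [mul_assoc, a.g_mul _ (a.I.mul_mem_right _ _ (hK h1))]
        exact M.mul_mem_left _ _ (h6 r))
    (by
      rintro x s ⟨h1, h2, h3, h4, h5, h6⟩
      refine ⟨K.mul_mem_right _ _ h1, M.mul_mem_right _ _ h2, ?_, h6 s, fun r => ?_, fun r => ?_⟩
      · rw [b.f_mul x (hM h2)]; exact K.mul_mem_right _ _ h3
      · rw [← mul_assoc, b.f_mul _ (b.I.mul_mem_left _ _ (hM h2))]
        exact K.mul_mem_right _ _ (h5 r)
      · rw [mul_assoc]; exact h6 _)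

theorem mem_mulIdeal {a b : Pre R} {K M : TwoSidedIdeal R} {hK : K ≤ a.I} {hM : M ≤ b.I} {x : R} :
    x ∈ mulIdeal a b K M hK hM ↔
      x ∈ K ∧ x ∈ M ∧ b.f x ∈ K ∧ a.g x ∈ M ∧ (∀ r, b.f (r * x) ∈ K) ∧ ∀ r, a.g (x * r) ∈ M :=
  TwoSidedIdeal.mem_mk' _ _ _ _ _ _ _

theorem mulIdeal_ne_bot [IsPrimeRing R] {a b : Pre R} {K M : TwoSidedIdeal R} (hK : K ≤ a.I)
    (hM : M ≤ b.I) (hK0 : K ≠ ⊥) (hM0 : M ≠ ⊥) : mulIdeal a b K M hK hM ≠ ⊥ := by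
  obtain ⟨i, hi, hi0⟩ := exists_mem_ne_zero hK0
  obtain ⟨j, hj, hj0⟩ := exists_mem_ne_zero hM0
  obtain ⟨r, hr⟩ := exists_mul_ne_zero hj0 hi0
  refine ne_bot_of_mem (x := j * r * i) (mem_mulIdeal.2 ⟨K.mul_mem_left _ _ hi,
    M.mul_mem_right _ _ (M.mul_mem_right _ _ hj), ?_, ?_, fun s => ?_, fun s => ?_⟩) hr
  · rw [b.f_mul _ (b.I.mul_mem_right _ _ (hM hj))]
    exact K.mul_mem_left _ _ hi
  · rw [mul_assoc, a.g_mul _ (a.I.mul_mem_left _ _ (hK hi))]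
    exact M.mul_mem_right _ _ hj
  · rw [← mul_assoc, b.f_mul _ (b.I.mul_mem_left _ _ (b.I.mul_mem_right _ _ (hM hj)))]
    exact K.mul_mem_left _ _ hi
  · rw [mul_assoc, mul_assoc,
      a.g_mul _ (a.I.mul_mem_left _ _ (a.I.mul_mem_right _ _ (hK hi)))]
    exact M.mul_mem_right _ _ hj

/-- Multiplication: `(q q') x = q (q' x)` and `x (q q') = (x q) q'`. -/
def mul [IsPrimeRing R] (a b : Pre R) : Pre R where
  I := mulIdeal a b a.I b.I le_rfl le_rfl
  ne_bot := mulIdeal_ne_bot le_rfl le_rfl a.ne_bot b.ne_bot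
  f x := a.f (b.f x)
  g x := b.g (a.g x)
  f_add x hx y hy := by
    rw [mem_mulIdeal] at hx hy
    rw [b.f_add x hx.2.1 y hy.2.1, a.f_add _ hx.2.2.1 _ hy.2.2.1]
  f_mul x hx r := by
    rw [mem_mulIdeal] at hx
    rw [b.f_mul x hx.2.1, a.f_mul _ hx.2.2.1]
  g_add x hx y hy := by
    rw [mem_mulIdeal] at hx hy
    rw [a.g_add x hx.1 y hy.1, b.g_add _ hx.2.2.2.1 _ hy.2.2.2.1]
  g_mul x hx r := by
    rw [mem_mulIdeal] at hx
    rw [a.g_mul x hx.1, b.g_mul _ hx.2.2.2.1]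
  balanced x hx y hy := by
    rw [mem_mulIdeal] at hx hy
    rw [a.balanced x hx.1 _ hy.2.2.1, b.balanced _ hx.2.2.2.1 y hy.2.1]

theorem maps_of_mem_mul [IsPrimeRing R] {a b : Pre R} {x : R} (hx : x ∈ (mul a b).I) :
    b.f x ∈ a.I ∧ a.g x ∈ b.I := by
  have hx' : x ∈ mulIdeal a b a.I b.I le_rfl le_rfl := hx
  rw [mem_mulIdeal] at hx'
  exact ⟨hx'.2.2.1, hx'.2.2.2.1⟩

theorem rel_of_eq [IsPrimeRing R] {a b : Pre R}
    (h : ∀ x ∈ a.I, x ∈ b.I → a.f x = b.f x ∧ a.g x = b.g x) : a ≈ b :=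
  ⟨a.I ⊓ b.I, inf_ne_bot a.ne_bot b.ne_bot, inf_le_left, inf_le_right, fun x hx =>
    h x ((TwoSidedIdeal.mem_inf _).1 hx).1 ((TwoSidedIdeal.mem_inf _).1 hx).2⟩

theorem neg_congr [IsPrimeRing R] {a b : Pre R} (h : a ≈ b) : neg a ≈ neg b := by
  obtain ⟨K, h0, ha, hb, h⟩ := h
  exact ⟨K, h0, ha, hb, fun x hx =>
    ⟨congrArg Neg.neg (h x hx).1, congrArg Neg.neg (h x hx).2⟩⟩

theorem add_congr [IsPrimeRing R] {a b c d : Pre R} (h : a ≈ b) (k : c ≈ d) :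
    add a c ≈ add b d := by
  obtain ⟨K, h0, ha, hb, h⟩ := h
  obtain ⟨M, k0, kc, kd, k⟩ := k
  refine ⟨K ⊓ M, inf_ne_bot h0 k0, inf_le_inf ha kc, inf_le_inf hb kd, fun x hx => ?_⟩
  obtain ⟨hK, hM⟩ := (TwoSidedIdeal.mem_inf _).1 hx
  exact ⟨congrArg₂ (· + ·) (h x hK).1 (k x hM).1, congrArg₂ (· + ·) (h x hK).2 (k x hM).2⟩

theorem mul_congr [IsPrimeRing R] {a b c d : Pre R} (h : a ≈ b) (k : c ≈ d) :
    mul a c ≈ mul b d := by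
  obtain ⟨K, h0, ha, hb, h⟩ := h
  obtain ⟨M, k0, kc, kd, k⟩ := k
  refine ⟨mulIdeal a c K M ha kc ⊓ ((mul a c).I ⊓ (mul b d).I),
    inf_ne_bot (mulIdeal_ne_bot ha kc h0 k0) (inf_ne_bot (mul a c).ne_bot (mul b d).ne_bot),
    inf_le_right.trans inf_le_left, inf_le_right.trans inf_le_right, fun x hx => ?_⟩
  obtain ⟨hK, hM, hf, hg, -⟩ := mem_mulIdeal.1 ((TwoSidedIdeal.mem_inf _).1 hx).1
  constructor
  · change a.f (c.f x) = b.f (d.f x)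
    rw [(h _ hf).1, (k x hM).1]
  · change c.g (a.g x) = d.g (b.g x)
    rw [(k _ hg).2, (h x hK).2]

end Pre

end Construction

/-- The Martindale symmetric ring of quotients of a prime ring `R`. -/
def SymQuot (R : Type*) [NonUnitalRing R] [IsPrimeRing R] : Type _ :=
  Quotient (Pre.setoid R)

namespace SymQuot

variable (R : Type*) [NonUnitalRing R] [IsPrimeRing R] [Nontrivial R]

instance instZero : Zero (SymQuot R) := ⟨Quotient.mk _ Pre.zero⟩

instance instOne : One (SymQuot R) := ⟨Quotient.mk _ Pre.one⟩

instance instNeg : Neg (SymQuot R) := ⟨Quotient.map Pre.neg fun _ _ h => Pre.neg_congr h⟩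

instance instAdd : Add (SymQuot R) :=
  ⟨Quotient.map₂ Pre.add fun _ _ h _ _ k => Pre.add_congr h k⟩

instance instMul : Mul (SymQuot R) :=
  ⟨Quotient.map₂ Pre.mul fun _ _ h _ _ k => Pre.mul_congr h k⟩

instance instRing : Ring (SymQuot R) where
  nsmul := nsmulRec
  zsmul := zsmulRec
  add_assoc := by
    rintro ⟨a⟩ ⟨b⟩ ⟨c⟩
    exact Quotient.sound (Pre.rel_of_eq fun x _ _ => ⟨add_assoc _ _ _, add_assoc _ _ _⟩)
  zero_add := by
    rintro ⟨a⟩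
    exact Quotient.sound (Pre.rel_of_eq fun x _ _ => ⟨zero_add _, zero_add _⟩)
  add_zero := by
    rintro ⟨a⟩
    exact Quotient.sound (Pre.rel_of_eq fun x _ _ => ⟨add_zero _, add_zero _⟩)
  add_comm := by
    rintro ⟨a⟩ ⟨b⟩
    exact Quotient.sound (Pre.rel_of_eq fun x _ _ => ⟨add_comm _ _, add_comm _ _⟩)
  neg_add_cancel := by
    rintro ⟨a⟩
    exact Quotient.sound (Pre.rel_of_eq fun x _ _ => ⟨neg_add_cancel _, neg_add_cancel _⟩)
  mul_assoc := by
    rintro ⟨a⟩ ⟨b⟩ ⟨c⟩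
    exact Quotient.sound (Pre.rel_of_eq fun x _ _ => ⟨rfl, rfl⟩)
  one_mul := by
    rintro ⟨a⟩
    exact Quotient.sound (Pre.rel_of_eq fun x _ _ => ⟨rfl, rfl⟩)
  mul_one := by
    rintro ⟨a⟩
    exact Quotient.sound (Pre.rel_of_eq fun x _ _ => ⟨rfl, rfl⟩)
  zero_mul := by
    rintro ⟨a⟩
    exact Quotient.sound (Pre.rel_of_eq fun x _ _ => ⟨rfl, a.g_zero⟩)
  mul_zero := by
    rintro ⟨a⟩
    exact Quotient.sound (Pre.rel_of_eq fun x _ _ => ⟨a.f_zero, rfl⟩)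
  left_distrib := by
    rintro ⟨a⟩ ⟨b⟩ ⟨c⟩
    refine Quotient.sound (Pre.rel_of_eq fun x _ hx => ?_)
    obtain ⟨h1, h2⟩ := (TwoSidedIdeal.mem_inf _).1 hx
    exact ⟨a.f_add _ (Pre.maps_of_mem_mul h1).1 _ (Pre.maps_of_mem_mul h2).1, rfl⟩
  right_distrib := by
    rintro ⟨a⟩ ⟨b⟩ ⟨c⟩
    refine Quotient.sound (Pre.rel_of_eq fun x _ hx => ?_)
    obtain ⟨h1, h2⟩ := (TwoSidedIdeal.mem_inf _).1 hx
    exact ⟨rfl, c.g_add _ (Pre.maps_of_mem_mul h1).2 _ (Pre.maps_of_mem_mul h2).2⟩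

/-- The canonical ring homomorphism from `R` to its symmetric ring of quotients. -/
def ι : R →ₙ+* SymQuot R where
  toFun r := Quotient.mk _ (Pre.ofRing r)
  map_mul' a b :=
    Quotient.sound (Pre.rel_of_eq fun x _ _ => ⟨mul_assoc a b x, (mul_assoc x a b).symm⟩)
  map_zero' := Quotient.sound (Pre.rel_of_eq fun x _ _ => ⟨zero_mul x, mul_zero x⟩)
  map_add' a b := Quotient.sound (Pre.rel_of_eq fun x _ _ => ⟨add_mul a b x, mul_add x a b⟩)

end SymQuot

end Martindale

open Martindale

section Ring

variable {R : Type*} [NonUnitalRing R]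

/-- `L` is a Lie ideal of `R`. -/
def IsLieIdeal (L : AddSubgroup R) : Prop :=
  ∀ x ∈ L, ∀ r : R, x * r - r * x ∈ L

/-- `L` is abelian, that is, `[L, L] = 0`. -/
def IsAbelian (L : AddSubgroup R) : Prop :=
  ∀ x ∈ L, ∀ y ∈ L, x * y - y * x = 0

/-- The iterated commutator `[a₁, [a₂, [⋯, [aₙ, x]⋯]]]` for a list `a₁, …, aₙ`. -/
def iterComm (a : List R) (x : R) : R :=
  a.foldr (fun b y => b * y - y * b) x

end Ring

section PrimeRing

variable (R : Type*) [NonUnitalRing R] [IsPrimeRing R] [Nontrivial R]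

/-- The extended centroid `C` of `R`: the center of the symmetric ring of quotients. -/
abbrev ExtendedCentroid : Subring (SymQuot R) :=
  Subring.center (SymQuot R)

variable {R} in
/-- For an additive subgroup `A` of `R`, the subgroup `A C` of the symmetric ring of quotients
generated by all products `a c`. Since `C` is central, this is the `C`-span of `A`. -/
def extC (A : AddSubgroup R) : Submodule (ExtendedCentroid R) (SymQuot R) :=
  Submodule.span (ExtendedCentroid R) (SymQuot.ι R '' (A : Set R))

/-- The central closure `R C`. -/
def centralClosure : Submodule (ExtendedCentroid R) (SymQuot R) :=
  extC (⊤ : AddSubgroup R)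

/-- `[R C, R C]`, the additive subgroup generated by all commutators of elements of `R C`. -/
def commCentralClosure : AddSubgroup (SymQuot R) :=
  AddSubgroup.closure
    {z | ∃ x ∈ centralClosure R, ∃ y ∈ centralClosure R, z = x * y - y * x}

/-- A prime ring is exceptional if it has characteristic two and `R C` has dimension four over
the extended centroid. -/
structure IsExceptional : Prop where
  char_two : ∀ x : R, 2 • x = 0
  rank_eq : Module.rank (ExtendedCentroid R) (centralClosure R) = 4

variable {R}

/-- `L` is nonabelian of Type I. -/
def IsTypeI (L : AddSubgroup R) : Prop :=
  ¬ IsAbelian L ∧ (extC L).toAddSubgroup = commCentralClosure R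

/-- `L` is nonabelian of Type II. -/
def IsTypeII (L : AddSubgroup R) : Prop :=
  ¬ IsAbelian L ∧ extC L = centralClosure R

end PrimeRing

/-! Write `Q` for the symmetric ring of quotients. For exceptional `R` the field `C` is the center
of `Q`, and `RC = Q` is a central simple `C`-algebra of dimension four. Over an algebraic closure
`F` of `C` it becomes the algebra of 2 × 2 matrices, so `R` embeds in `M₂(F)` with `F`-span
everything. Under this embedding central elements are the scalar ones and elements of `[RC, RC]` are
those of trace zero (`IsExceptional.exists_matrix_embedding`).

What remains is linear algebra. Polarizing Cayley–Hamilton in characteristic two gives `[A, X] ≡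
tr(A) X` modulo scalars whenever `tr X = 0`. Scalars vanish in the next commutator, so `[A₁, …, Aₘ,
X] ≡ tr(A₁)⋯tr(Aₘ) X`. This is scalar exactly when some `Aᵢ` has trace zero or `X` is scalar
(`Matrix.iterComm_mem_span_one_iff`).

In (i) all of `L` has trace zero: for Type I because `LC = [RC, RC]`, for abelian `L` because `(ad
x)² = 0` forces `tr(x)² = 0`. A noncentral element of `L` then decides the question. In (ii) `L`
spans `M₂(F)`, so the criterion is applied to the trace-zero elements `[aₙ, x]`; if all of these are
scalar, then so is `aₙ`. -/

namespace Martindale.SymQuot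


/-! ### The symmetric ring of quotients is prime and its center is a field. -/

variable {R : Type*} [NonUnitalRing R] [IsPrimeRing R]

/-- The element of the symmetric ring of quotients represented by a balanced pair. -/
def mk (a : Pre R) : SymQuot R := Quotient.mk (Pre.setoid R) a

theorem exists_eq_mk (q : SymQuot R) : ∃ a, q = mk a := by
  obtain ⟨a⟩ := q
  exact ⟨a, rfl⟩

variable [Nontrivial R]

/-- The left multiplications agree by right linearity of `a.f`, the right ones by balancedness. -/
theorem mk_mul_ι (a : Pre R) {x : R} (hx : x ∈ a.I) :
    mk a * ι R x = ι R (a.f x) := by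
  refine Quotient.sound (Pre.rel_of_eq fun y hy _ => ⟨a.f_mul x hx y, ?_⟩)
  have h := (Pre.mem_mulIdeal (a := a) (b := Pre.ofRing x) (hK := le_rfl) (hM := le_rfl)).1 hy
  exact (a.balanced y h.1 x hx).symm

theorem ι_mul_mk (a : Pre R) {x : R} (hx : x ∈ a.I) :
    ι R x * mk a = ι R (a.g x) := by
  refine Quotient.sound (Pre.rel_of_eq fun y hy _ => ⟨?_, a.g_mul x hx y⟩)
  exact a.balanced x hx y
    ((Pre.mem_mulIdeal (a := Pre.ofRing x) (b := a) (hK := le_rfl) (hM := le_rfl)).1 hy).2.1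

theorem ι_injective : Function.Injective (ι R) := by
  rw [injective_iff_map_eq_zero]
  intro r hr
  obtain ⟨K, hK, -, -, h⟩ := Quotient.exact hr
  obtain ⟨x, hx, hx0⟩ := exists_mem_ne_zero hK
  by_contra hr0
  obtain ⟨y, hy⟩ := exists_mul_ne_zero hr0 hx0
  refine hy ?_
  rw [mul_assoc]
  exact (h _ (K.mul_mem_left y x hx)).1

/-- The common domain of definition of multiplication by `q` on both sides. -/
theorem exists_ideal (q : SymQuot R) : ∃ I : TwoSidedIdeal R, I ≠ ⊥ ∧
    ∀ x ∈ I, (∃ y, q * ι R x = ι R y) ∧ ∃ y, ι R x * q = ι R y := by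
  obtain ⟨a, rfl⟩ := exists_eq_mk q
  exact ⟨a.I, a.ne_bot, fun x hx => ⟨⟨_, mk_mul_ι a hx⟩, ⟨_, ι_mul_mk a hx⟩⟩⟩

/-- Multiplication by `q` on both sides sends some nonzero ideal contained in `I` to `I`. -/
theorem exists_ideal_le (q : SymQuot R) {I : TwoSidedIdeal R} (hI : I ≠ ⊥) :
    ∃ J : TwoSidedIdeal R, J ≠ ⊥ ∧ J ≤ I ∧
      ∀ x ∈ J, (∃ y ∈ I, q * ι R x = ι R y) ∧ ∃ y ∈ I, ι R x * q = ι R y := by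
  obtain ⟨a, rfl⟩ := exists_eq_mk q
  have h0 := inf_ne_bot hI a.ne_bot
  refine ⟨Pre.mulIdeal a a (I ⊓ a.I) (I ⊓ a.I) inf_le_right inf_le_right,
    Pre.mulIdeal_ne_bot _ _ h0 h0, fun x hx => ?_, fun x hx => ?_⟩
  · exact ((TwoSidedIdeal.mem_inf _).1 (Pre.mem_mulIdeal.1 hx).1).1
  · obtain ⟨h1, -, h2, h3, -⟩ := Pre.mem_mulIdeal.1 hx
    rw [TwoSidedIdeal.mem_inf] at h1 h2 h3
    exact ⟨⟨_, h2.1, mk_mul_ι a h1.2⟩, ⟨_, h3.1, ι_mul_mk a h1.2⟩⟩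

/-- Only `a.f` is assumed to vanish. Balancedness gives `a.g y * (r * x) = y * a.f (r * x) = 0` for
all `r`, and primeness then makes `a.g` vanish too. -/
theorem eq_zero_of_mul_ι {q : SymQuot R} {K : TwoSidedIdeal R} (hK : K ≠ ⊥)
    (h : ∀ x ∈ K, q * ι R x = 0) : q = 0 := by
  obtain ⟨a, rfl⟩ := exists_eq_mk q
  have hf : ∀ x ∈ K, x ∈ a.I → a.f x = 0 := fun x hx ha =>
    ι_injective (by rw [← mk_mul_ι a ha, map_zero]; exact h x hx)
  obtain ⟨x, hx, hx0⟩ := exists_mem_ne_zero (inf_ne_bot hK a.ne_bot)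
  rw [TwoSidedIdeal.mem_inf] at hx
  refine Quotient.sound ⟨K ⊓ a.I, inf_ne_bot hK a.ne_bot, inf_le_right, fun _ _ => trivial,
    fun y hy => ?_⟩
  rw [TwoSidedIdeal.mem_inf] at hy
  refine ⟨hf y hy.1 hy.2, ?_⟩
  refine (IsPrimeRing.eq_zero_or_eq_zero (a.g y) x fun r => ?_).resolve_right hx0
  rw [mul_assoc, ← a.balanced y hy.2 _ (a.I.mul_mem_left r x hx.2),
    hf _ (K.mul_mem_left r x hx.1) (a.I.mul_mem_left r x hx.2), mul_zero]

theorem eq_zero_of_ι_mul {q : SymQuot R} {K : TwoSidedIdeal R} (hK : K ≠ ⊥)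
    (h : ∀ x ∈ K, ι R x * q = 0) : q = 0 := by
  obtain ⟨a, rfl⟩ := exists_eq_mk q
  have hg : ∀ x ∈ K, x ∈ a.I → a.g x = 0 := fun x hx ha =>
    ι_injective (by rw [← ι_mul_mk a ha, map_zero]; exact h x hx)
  obtain ⟨x, hx, hx0⟩ := exists_mem_ne_zero (inf_ne_bot hK a.ne_bot)
  rw [TwoSidedIdeal.mem_inf] at hx
  refine Quotient.sound ⟨K ⊓ a.I, inf_ne_bot hK a.ne_bot, inf_le_right, fun _ _ => trivial,
    fun y hy => ?_⟩
  rw [TwoSidedIdeal.mem_inf] at hy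
  refine ⟨?_, hg y hy.1 hy.2⟩
  refine (IsPrimeRing.eq_zero_or_eq_zero x (a.f y) fun r => ?_).resolve_left hx0
  rw [a.balanced _ (a.I.mul_mem_right x r hx.2) y hy.2,
    hg _ (K.mul_mem_right x r hx.1) (a.I.mul_mem_right x r hx.2), zero_mul]

/-- If `a` and `b` are nonzero, then `a x` and `y b` are nonzero elements of `R` for suitable `x`,
`y` in `R`, and primeness of `R` applies to them. -/
theorem eq_zero_or_eq_zero_of_forall_mul_mul (a b : SymQuot R) (h : ∀ x, a * x * b = 0) :
    a = 0 ∨ b = 0 := by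
  by_contra! H
  obtain ⟨I, hI, ha⟩ := exists_ideal a
  obtain ⟨J, hJ, hb⟩ := exists_ideal b
  obtain ⟨x, hx, hx0⟩ : ∃ x ∈ I, a * ι R x ≠ 0 := by
    by_contra! H'
    exact H.1 (eq_zero_of_mul_ι hI H')
  obtain ⟨y, hy, hy0⟩ : ∃ y ∈ J, ι R y * b ≠ 0 := by
    by_contra! H'
    exact H.2 (eq_zero_of_ι_mul hJ H')
  obtain ⟨u, hu⟩ := (ha x hx).1
  obtain ⟨v, hv⟩ := (hb y hy).2
  rw [hu] at hx0
  rw [hv] at hy0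
  obtain ⟨r, hr⟩ := exists_mul_ne_zero (a := u) (b := v)
    (fun h => hx0 (by rw [h, map_zero])) (fun h => hy0 (by rw [h, map_zero]))
  refine hr (ι_injective ?_)
  have := h (ι R x * ι R r * ι R y)
  rw [map_zero, map_mul, map_mul, ← hu, ← hv, ← this]
  simp only [mul_assoc]

instance instNontrivial : Nontrivial (SymQuot R) := ι_injective.nontrivial

theorem eq_zero_of_mem_center_mul {c q : SymQuot R} (hc : c ∈ Subring.center (SymQuot R))
    (hc0 : c ≠ 0) (h : c * q = 0) : q = 0 := by
  refine (eq_zero_or_eq_zero_of_forall_mul_mul c q fun x => ?_).resolve_left hc0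
  rw [← Subring.mem_center_iff.1 hc x, mul_assoc, h, mul_zero]

/-- A nonzero central `c` acts on its domain `I` as an injective bimodule map. Its image `J = cI` is
a nonzero ideal, and the inverse map `J → I` is a balanced pair representing the inverse of `c`. -/
theorem exists_mul_eq_one_of_mem_center {c : SymQuot R} (hc : c ∈ Subring.center (SymQuot R))
    (hc0 : c ≠ 0) : ∃ d : SymQuot R, d * c = 1 := by
  obtain ⟨a, rfl⟩ := exists_eq_mk c
  have hfg : ∀ x ∈ a.I, a.g x = a.f x := fun x hx => ι_injective (by
    rw [← ι_mul_mk a hx, ← mk_mul_ι a hx]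
    exact Subring.mem_center_iff.1 hc _)
  have hinj : ∀ x ∈ a.I, ∀ y ∈ a.I, a.f x = a.f y → x = y := fun x hx y hy hxy => by
    refine sub_eq_zero.1 (ι_injective ?_)
    rw [map_zero]
    refine eq_zero_of_mem_center_mul hc hc0 ?_
    rw [map_sub, mul_sub, mk_mul_ι a hx, mk_mul_ι a hy, hxy, sub_self]
  have hmul : ∀ x ∈ a.I, ∀ r, a.f (r * x) = r * a.f x := fun x hx r => by
    rw [← hfg _ (a.I.mul_mem_left r x hx), a.g_mul x hx, hfg x hx]
  let J : TwoSidedIdeal R := TwoSidedIdeal.mk' {y | ∃ x ∈ a.I, a.f x = y}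
    ⟨0, a.I.zero_mem, a.f_zero⟩
    (by
      rintro _ _ ⟨x, hx, rfl⟩ ⟨y, hy, rfl⟩
      exact ⟨x + y, a.I.add_mem hx hy, a.f_add x hx y hy⟩)
    (by
      rintro _ ⟨x, hx, rfl⟩
      exact ⟨-x, a.I.neg_mem hx, a.f_neg hx⟩)
    (by
      rintro r _ ⟨x, hx, rfl⟩
      exact ⟨r * x, a.I.mul_mem_left r x hx, hmul x hx r⟩)
    (by
      rintro _ r ⟨x, hx, rfl⟩
      exact ⟨x * r, a.I.mul_mem_right x r hx, a.f_mul x hx r⟩)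
  have hJ : ∀ y, y ∈ J ↔ ∃ x ∈ a.I, a.f x = y := fun y => TwoSidedIdeal.mem_mk' _ _ _ _ _ _ _
  -- The inverse map must be a function on all of `R`; its values off `J` are irrelevant.
  have hp : ∀ y, ∃ x, y ∈ J → x ∈ a.I ∧ a.f x = y := fun y => by
    by_cases h : y ∈ J
    · obtain ⟨x, hx⟩ := (hJ y).1 h
      exact ⟨x, fun _ => hx⟩
    · exact ⟨0, fun h' => absurd h' h⟩
  choose p hp using hp
  have hpf : ∀ x ∈ a.I, p (a.f x) = x := fun x hx =>
    have h := hp (a.f x) ((hJ _).2 ⟨x, hx, rfl⟩)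
    hinj _ h.1 _ hx h.2
  have hpadd : ∀ x ∈ J, ∀ y ∈ J, p (x + y) = p x + p y := fun x hx y hy => by
    obtain ⟨x, hx', rfl⟩ := (hJ _).1 hx
    obtain ⟨y, hy', rfl⟩ := (hJ _).1 hy
    rw [← a.f_add x hx' y hy', hpf _ (a.I.add_mem hx' hy'), hpf x hx', hpf y hy']
  let b : Pre R :=
    { I := J
      ne_bot := by
        obtain ⟨x, hx, hx0⟩ := exists_mem_ne_zero a.ne_bot
        refine ne_bot_of_mem ((hJ (a.f x)).2 ⟨x, hx, rfl⟩) fun h => hx0 ?_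
        exact hinj x hx 0 a.I.zero_mem (h.trans a.f_zero.symm)
      f := p
      g := p
      f_add := hpadd
      f_mul := fun x hx r => by
        obtain ⟨x, hx', rfl⟩ := (hJ _).1 hx
        rw [← a.f_mul x hx', hpf x hx', hpf _ (a.I.mul_mem_right x r hx')]
      g_add := hpadd
      g_mul := fun x hx r => by
        obtain ⟨x, hx', rfl⟩ := (hJ _).1 hx
        rw [← hmul x hx', hpf x hx', hpf _ (a.I.mul_mem_left r x hx')]
      balanced := fun x hx y hy => by
        obtain ⟨x, hx', rfl⟩ := (hJ _).1 hx
        obtain ⟨y, hy', rfl⟩ := (hJ _).1 hy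
        rw [hpf x hx', hpf y hy', ← hfg x hx', a.balanced x hx' y hy'] }
  refine ⟨mk b, Quotient.sound (Pre.rel_of_eq fun y hy _ => ?_)⟩
  obtain ⟨h1, h2, -⟩ :=
    (Pre.mem_mulIdeal (a := b) (b := a) (hK := le_rfl) (hM := le_rfl)).1 hy
  refine ⟨hpf y h2, ?_⟩
  change a.g (p y) = y
  obtain ⟨x, hx, rfl⟩ := (hJ _).1 h1
  rw [hpf x hx, hfg x hx]

theorem isField_extendedCentroid : IsField (ExtendedCentroid R) where
  exists_pair_ne := ⟨0, 1, zero_ne_one⟩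
  mul_comm := mul_comm
  mul_inv_cancel := fun {c} hc0 => by
    have h0 : (c : SymQuot R) ≠ 0 := fun h => hc0 (Subtype.ext h)
    obtain ⟨d, hd⟩ := exists_mul_eq_one_of_mem_center c.2 h0
    have hdc : d ∈ Subring.center (SymQuot R) := Subring.mem_center_iff.2 fun q => by
      refine sub_eq_zero.1 (eq_zero_of_mem_center_mul c.2 h0 ?_)
      have hc := Subring.mem_center_iff.1 c.2
      rw [mul_sub, ← mul_assoc, ← mul_assoc, ← hc q, mul_assoc, ← hc d, hd, mul_one, one_mul,
        sub_self]
    refine ⟨⟨d, hdc⟩, Subtype.ext ?_⟩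
    change (c : SymQuot R) * d = 1
    rw [← hd]
    exact (Subring.mem_center_iff.1 c.2 d).symm

end Martindale.SymQuot

/-! ### Finite-dimensional central simple algebras and their splitting. -/

section CentralSimple

open scoped TensorProduct

/-- The Jacobson radical of an Artinian ring is nilpotent, hence zero by primeness, so the ring is
semisimple. A nonzero two-sided ideal `I` has a complementary left ideal `J`; since `I B J ⊆ I ∩ J =
0`, primeness gives `J = 0`. -/
theorem IsSimpleRing.of_forall_mul_mul (K : Type*) {B : Type*} [Field K] [Ring B] [Algebra K B]
    [FiniteDimensional K B] [Nontrivial B]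
    (h : ∀ a b : B, (∀ x, a * x * b = 0) → a = 0 ∨ b = 0) : IsSimpleRing B := by
  have := IsArtinianRing.of_finite K B
  have hjac : Ring.jacobson B = ⊥ := by
    have hn : IsNilpotent (Ring.jacobson B) := IsSemiprimaryRing.isNilpotent
    obtain ⟨n, hn⟩ := hn
    by_contra hne
    obtain ⟨x, hx, hx0⟩ := Submodule.exists_mem_ne_zero_of_ne_bot hne
    -- No power of a nonzero radical vanishes: for nonzero `y` in the `k`-th power, some `x * z * y`
    -- is a nonzero element of the next.
    have key : ∀ k, ∃ y ∈ Ring.jacobson B ^ k, y ≠ 0 := fun k => by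
      induction k with
      | zero => exact ⟨1, by simp [Submodule.pow_zero, Ideal.one_eq_top], one_ne_zero⟩
      | succ k ih =>
        obtain ⟨y, hy, hy0⟩ := ih
        by_contra! H
        rcases h x y fun z => H _ (by
          rw [Ideal.IsTwoSided.pow_succ, mul_assoc]
          exact Ideal.mul_mem_mul hx (Ideal.mul_mem_left _ z hy)) with h | h
        exacts [hx0 h, hy0 h]
    obtain ⟨y, hy, hy0⟩ := key n
    rw [hn] at hy
    exact hy0 hy
  have hss : IsSemisimpleRing B := IsArtinianRing.isSemisimpleRing_iff_jacobson.2 hjac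
  refine isSimpleRing_iff_isTwoSided_imp.2 ⟨inferInstance, fun I hI => or_iff_not_imp_left.2
    fun hI0 => ?_⟩
  obtain ⟨J, hJ⟩ := exists_isCompl I
  have hJ0 : J = ⊥ := by
    by_contra hJ0
    obtain ⟨x, hx, hx0⟩ := Submodule.exists_mem_ne_zero_of_ne_bot hI0
    obtain ⟨y, hy, hy0⟩ := Submodule.exists_mem_ne_zero_of_ne_bot hJ0
    rcases h x y fun z => Submodule.disjoint_def.1 hJ.disjoint _
      (hI.mul_mem_of_left _ (hI.mul_mem_of_left _ hx)) (Ideal.mul_mem_left _ _ hy) with h | h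
    exacts [hx0 h, hy0 h]
  simpa [hJ0] using hJ.sup_eq_top

variable {K B : Type*} [Field K] [Ring B] [Algebra K B]

theorem mulLeft_mem_range_mulLeftRight (x : B) :
    LinearMap.mulLeft K x ∈ (AlgHom.mulLeftRight K B).range :=
  ⟨x ⊗ₜ 1, by ext; simp⟩

theorem mulRight_mem_range_mulLeftRight (x : B) :
    LinearMap.mulRight K x ∈ (AlgHom.mulLeftRight K B).range :=
  ⟨1 ⊗ₜ MulOpposite.op x, by ext; simp⟩

variable [IsSimpleRing B] [Algebra.IsCentral K B]

/-- A density argument by induction on `s`: simplicity and centrality provide multiplication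
operators dual to any finite independent family. -/
theorem LinearIndependent.exists_mem_range_mulLeftRight_dual {ι : Type*} [DecidableEq ι]
    {b : ι → B} (hb : LinearIndependent K b) (s : Finset ι) :
    ∃ D : ι → Module.End K B, ∀ i ∈ s, D i ∈ (AlgHom.mulLeftRight K B).range ∧
      ∀ k ∈ s, D i (b k) = if k = i then 1 else 0 := by
  set M := (AlgHom.mulLeftRight K B).range
  have hL : ∀ x, LinearMap.mulLeft K x ∈ M := mulLeft_mem_range_mulLeftRight
  have hR : ∀ x, LinearMap.mulRight K x ∈ M := mulRight_mem_range_mulLeftRight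
  induction s using Finset.induction_on with
  | empty => exact ⟨0, by simp⟩
  | insert j s hj ih =>
    obtain ⟨D, hD⟩ := ih
    obtain ⟨E, hE, hE0, hEj⟩ : ∃ E ∈ M, (∀ k ∈ s, E (b k) = 0) ∧ E (b j) ≠ 0 := by
      by_contra! H
      -- The difference of `a` and `∑ L_{a (b i)} D i` kills every `b k` with `k ∈ s`, hence also `b
      -- j`. Taking `a = R_x D i` will show that `D i (b j)` is central, and `a = 1` will make `b j`
      -- dependent on the earlier vectors.
      have key : ∀ a ∈ M, a (b j) = ∑ i ∈ s, a (b i) * D i (b j) := fun a ha => by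
        have := H (a - ∑ i ∈ s, LinearMap.mulLeft K (a (b i)) * D i)
          (M.sub_mem ha (M.sum_mem fun i hi => M.mul_mem (hL _) (hD i hi).1)) fun k hk => by
            have h1 : ∑ i ∈ s, a (b i) * D i (b k) = ∑ i ∈ s, if k = i then a (b i) else 0 :=
              Finset.sum_congr rfl fun i hi => by rw [(hD i hi).2 k hk]; simp
            simp [LinearMap.sum_apply, h1, hk]
        simpa [LinearMap.sum_apply, sub_eq_zero] using this
      have hc : ∀ i ∈ s, ∃ z : K, algebraMap K B z = D i (b j) := fun i hi => by
        have : D i (b j) ∈ Subalgebra.center K B := Subalgebra.mem_center_iff.2 fun x => by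
          have := key (LinearMap.mulRight K x * D i) (M.mul_mem (hR x) (hD i hi).1)
          have h1 : ∑ k ∈ s, (LinearMap.mulRight K x * D i) (b k) * D k (b j)
              = ∑ k ∈ s, if k = i then x * D k (b j) else 0 :=
            Finset.sum_congr rfl fun k hk => by
              rw [Module.End.mul_apply, (hD i hi).2 k hk]; split_ifs <;> simp
          rw [h1] at this
          simpa [hi] using this.symm
        obtain ⟨z, hz⟩ := (Algebra.IsCentral.mem_center_iff K).1 this
        exact ⟨z, hz.symm⟩
      refine hb.notMem_span_image (s := (s : Set ι)) (x := j) (by simpa using hj) ?_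
      have h1 := key 1 M.one_mem
      rw [Module.End.one_apply] at h1
      rw [h1]
      refine Submodule.sum_mem _ fun i hi => ?_
      obtain ⟨z, hz⟩ := hc i hi
      rw [Module.End.one_apply, ← hz, ← Algebra.commutes, ← Algebra.smul_def]
      exact Submodule.smul_mem _ _ (Submodule.subset_span ⟨i, hi, rfl⟩)
    -- The possible values at `b j` form a nonzero two-sided ideal, so 1 is among them.
    let N : TwoSidedIdeal B := TwoSidedIdeal.mk'
      {y | ∃ E ∈ M, (∀ k ∈ s, E (b k) = 0) ∧ E (b j) = y}
      ⟨0, M.zero_mem, by simp, by simp⟩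
      (by
        rintro _ _ ⟨E, hE, hE0, rfl⟩ ⟨E', hE', hE0', rfl⟩
        exact ⟨E + E', M.add_mem hE hE', fun k hk => by simp [hE0 k hk, hE0' k hk], by simp⟩)
      (by
        rintro _ ⟨E, hE, hE0, rfl⟩
        exact ⟨-E, M.neg_mem hE, fun k hk => by simp [hE0 k hk], by simp⟩)
      (by
        rintro x _ ⟨E, hE, hE0, rfl⟩
        exact ⟨_, M.mul_mem (hL x) hE, fun k hk => by simp [hE0 k hk], by simp⟩)
      (by
        rintro _ x ⟨E, hE, hE0, rfl⟩
        exact ⟨_, M.mul_mem (hR x) hE, fun k hk => by simp [hE0 k hk], by simp⟩)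
    have hN : ∀ y, y ∈ N ↔ ∃ E ∈ M, (∀ k ∈ s, E (b k) = 0) ∧ E (b j) = y :=
      fun y => TwoSidedIdeal.mem_mk' _ _ _ _ _ _ _
    obtain ⟨E, hE, hE0, hEj⟩ : ∃ E ∈ M, (∀ k ∈ s, E (b k) = 0) ∧ E (b j) = 1 :=
      (hN _).1 (IsSimpleRing.one_mem_of_ne_zero_mem N hEj ((hN _).2 ⟨E, hE, hE0, rfl⟩))
    -- Each old operator is corrected to vanish at `b j`; its values on the earlier vectors are
    -- unchanged because `E` kills them.
    refine ⟨fun i => if i = j then E else D i - LinearMap.mulLeft K (D i (b j)) * E,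
      fun i hi => ?_⟩
    by_cases hij : i = j
    · subst hij
      refine ⟨by simpa only [if_true] using hE, fun k hk => ?_⟩
      rcases Finset.mem_insert.1 hk with rfl | hk
      · simp [hEj]
      · have : k ≠ i := fun h => hj (h ▸ hk)
        simp [hE0 k hk, this]
    · have his := (Finset.mem_insert.1 hi).resolve_left hij
      refine ⟨by
        simpa only [hij, if_false] using M.sub_mem (hD i his).1 (M.mul_mem (hL _) hE),
        fun k hk => ?_⟩
      rcases Finset.mem_insert.1 hk with rfl | hk
      · simp [hij, hEj, Ne.symm hij]
      · simp [hij, hE0 k hk, (hD i his).2 k hk]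

/-- The multiplication algebra of a central simple algebra contains all linear endomorphisms. -/
theorem mulLeftRight_surjective_of_isSimpleRing [FiniteDimensional K B] :
    Function.Surjective (AlgHom.mulLeftRight K B) := by
  classical
  intro f
  let b := Module.finBasis K B
  obtain ⟨D, hD⟩ := b.linearIndependent.exists_mem_range_mulLeftRight_dual Finset.univ
  have : f = ∑ i, LinearMap.mulLeft K (f (b i)) * D i := b.ext fun k => by
    have h1 : ∑ i, f (b i) * D i (b k) = ∑ i, if k = i then f (b i) else 0 :=
      Finset.sum_congr rfl fun i hi => by rw [(hD i hi).2 k (Finset.mem_univ _)]; simp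
    simp [LinearMap.sum_apply, h1]
  change f ∈ (AlgHom.mulLeftRight K B).range
  rw [this]
  exact Subalgebra.sum_mem _ fun i hi =>
    Subalgebra.mul_mem _ (mulLeft_mem_range_mulLeftRight _) (hD i hi).1

variable (K B) in
-- Write a nonzero element of an ideal as `∑ fᵢ ⊗ bᵢ` with `fⱼ ≠ 0`. The multiplication operator
-- sending `bⱼ` to 1 and the other basis vectors to 0 turns it into the unit `fⱼ ⊗ 1`, still in the
-- ideal.
theorem IsSimpleRing.tensorProduct (F : Type*) [Field F] [Algebra K F] [FiniteDimensional K B] :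
    IsSimpleRing (F ⊗[K] B) := by
  classical
  have : Nontrivial (F ⊗[K] B) := inferInstance
  refine IsSimpleRing.of_eq_bot_or_eq_top fun I => or_iff_not_imp_left.2 fun hI => ?_
  obtain ⟨x, hx, hx0⟩ : ∃ x ∈ I, x ≠ 0 := Martindale.exists_mem_ne_zero hI
  let b := Module.finBasis K B
  let bF := Algebra.TensorProduct.basis F b
  obtain ⟨j, hj⟩ : ∃ j, bF.repr x j ≠ 0 := by
    by_contra! H
    exact hx0 (bF.repr.map_eq_zero_iff.1 (Finsupp.ext H))
  have key : ∀ y : B ⊗[K] Bᵐᵒᵖ, (AlgHom.mulLeftRight K B y).lTensor F x ∈ I := fun y => by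
    induction y using TensorProduct.induction_on with
    | zero => simp
    | add y z hy hz =>
      rw [map_add, LinearMap.lTensor_add, LinearMap.add_apply]
      exact I.add_mem hy hz
    | tmul u v =>
      have : ∀ x : F ⊗[K] B, (AlgHom.mulLeftRight K B (u ⊗ₜ v)).lTensor F x
          = (1 ⊗ₜ u) * x * (1 ⊗ₜ v.unop) := fun x => by
        induction x using TensorProduct.induction_on with
        | zero => simp
        | add x y hx hy => rw [map_add, hx, hy, mul_add, add_mul]
        | tmul f c => simp
      rw [this]
      exact I.mul_mem_right _ _ (I.mul_mem_left _ _ hx)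
  obtain ⟨y, hy⟩ := mulLeftRight_surjective_of_isSimpleRing (K := K) (B := B)
    (b.constr K fun i => if i = j then (1 : B) else 0)
  have h1 : (AlgHom.mulLeftRight K B y).lTensor F x = bF.repr x j ⊗ₜ 1 := by
    conv_lhs => rw [← bF.sum_repr x]
    simp only [bF, Algebra.TensorProduct.basis_apply, TensorProduct.smul_tmul', map_sum,
      LinearMap.lTensor_tmul, hy, Module.Basis.constr_basis, smul_eq_mul, mul_one,
      TensorProduct.tmul_ite, Finset.sum_ite_eq', Finset.mem_univ,
      if_true]
  have h2 := I.mul_mem_left ((bF.repr x j)⁻¹ ⊗ₜ 1) _ (key y)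
  rw [h1, Algebra.TensorProduct.tmul_mul_tmul, inv_mul_cancel₀ hj, mul_one,
    ← Algebra.TensorProduct.one_def] at h2
  exact (TwoSidedIdeal.one_mem_iff _).1 h2

variable (K B) in
/-- A four-dimensional central simple algebra becomes an algebra of `2 × 2` matrices over some
extension field. -/
theorem exists_algHom_matrix_two (h4 : Module.finrank K B = 4) :
    ∃ φ : B →ₐ[K] Matrix (Fin 2) (Fin 2) (AlgebraicClosure K),
      Submodule.span (AlgebraicClosure K) (Set.range φ) = ⊤ := by
  have : FiniteDimensional K B := FiniteDimensional.of_finrank_pos (by omega)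
  let F := AlgebraicClosure K
  have := IsSimpleRing.tensorProduct K B F
  obtain ⟨n, _, ⟨e⟩⟩ := IsSimpleRing.exists_algEquiv_matrix_of_isAlgClosed F (F ⊗[K] B)
  have hn : n = 2 := by
    have h := e.toLinearEquiv.finrank_eq
    rw [Module.finrank_baseChange, h4, Module.finrank_matrix] at h
    simp only [Fintype.card_fin, Module.finrank_self, mul_one] at h
    nlinarith
  subst hn
  refine ⟨(e.toAlgHom.restrictScalars K).comp Algebra.TensorProduct.includeRight,
    Submodule.eq_top_iff'.2 fun x => ?_⟩
  obtain ⟨y, rfl⟩ := e.surjective x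
  induction y using TensorProduct.induction_on with
  | zero => simp
  | add x y hx hy => rw [map_add]; exact Submodule.add_mem _ hx hy
  | tmul f c =>
    rw [← mul_one f, ← smul_eq_mul, ← TensorProduct.smul_tmul', map_smul]
    exact Submodule.smul_mem _ _ (Submodule.subset_span ⟨c, rfl⟩)

end CentralSimple

/-! ### A finite-dimensional central closure is the whole quotient ring. -/

namespace Martindale.SymQuot

variable {R : Type*} [NonUnitalRing R] [IsPrimeRing R] [Nontrivial R]

noncomputable instance instFieldExtendedCentroid : Field (ExtendedCentroid R) :=
  isField_extendedCentroid.toField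

instance instIsCentral : Algebra.IsCentral (ExtendedCentroid R) (SymQuot R) where
  out x hx := ⟨⟨x, Subring.mem_center_iff.2 (Subalgebra.mem_center_iff.1 hx)⟩, rfl⟩

/-- If the central closure is finite-dimensional, then the spans of the nonzero ideals of `R` have
a least element; it is an ideal of the symmetric ring of quotients. -/
theorem exists_ideal_span_stable [FiniteDimensional (ExtendedCentroid R) (centralClosure R)] :
    ∃ I : TwoSidedIdeal R, I ≠ ⊥ ∧
      ∀ q, ∀ m ∈ Submodule.span (ExtendedCentroid R) (ι R '' (I : Set R)),
        q * m ∈ Submodule.span (ExtendedCentroid R) (ι R '' (I : Set R)) ∧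
        m * q ∈ Submodule.span (ExtendedCentroid R) (ι R '' (I : Set R)) := by
  let S : TwoSidedIdeal R → Submodule (ExtendedCentroid R) (SymQuot R) :=
    fun I => Submodule.span (ExtendedCentroid R) (ι R '' (I : Set R))
  have hS : ∀ I, S I ≤ centralClosure R := fun I =>
    Submodule.span_mono (Set.image_mono fun _ _ => trivial)
  have hfin : ∀ I, FiniteDimensional (ExtendedCentroid R) (S I) := fun I =>
    Submodule.finiteDimensional_of_le (hS I)
  obtain ⟨I, hI, hmin⟩ := WellFounded.has_min
    (measure fun I : TwoSidedIdeal R => Module.finrank (ExtendedCentroid R) (S I)).wf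
    {I | I ≠ ⊥} ⟨⊤, top_ne_bot⟩
  refine ⟨I, hI, fun q m hm => ?_⟩
  -- Multiplication by `q` sends `J` into `I`, and minimality of the dimension makes `J` and `I`
  -- have the same span.
  obtain ⟨J, hJ, hJI, hq⟩ := exists_ideal_le q hI
  have hJS : S J = S I := Submodule.eq_of_le_of_finrank_le
    (Submodule.span_mono (Set.image_mono hJI)) (not_lt.1 (hmin J hJ))
  change m ∈ S I at hm
  rw [← hJS] at hm
  induction hm using Submodule.span_induction with
  | mem m hm =>
    obtain ⟨x, hx, rfl⟩ := hm
    obtain ⟨⟨y, hy, hxy⟩, z, hz, hxz⟩ := hq x hx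
    rw [hxy, hxz]
    exact ⟨Submodule.subset_span ⟨y, hy, rfl⟩, Submodule.subset_span ⟨z, hz, rfl⟩⟩
  | zero => simp
  | add m m' _ _ h h' =>
    rw [mul_add, add_mul]
    exact ⟨Submodule.add_mem _ h.1 h'.1, Submodule.add_mem _ h.2 h'.2⟩
  | smul c m _ h =>
    rw [mul_smul_comm, smul_mul_assoc]
    exact ⟨Submodule.smul_mem _ c h.1, Submodule.smul_mem _ c h.2⟩

variable (R) in
-- Left multiplication on the finite-dimensional stable span `M` is faithful, so the quotient ring
-- embeds in `End M`.
theorem finiteDimensional_of_centralClosure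
    [FiniteDimensional (ExtendedCentroid R) (centralClosure R)] :
    FiniteDimensional (ExtendedCentroid R) (SymQuot R) := by
  obtain ⟨I, hI, hM⟩ := exists_ideal_span_stable (R := R)
  set M := Submodule.span (ExtendedCentroid R) (ι R '' (I : Set R))
  have hMle : M ≤ centralClosure R := Submodule.span_mono (Set.image_mono fun _ _ => trivial)
  have : FiniteDimensional (ExtendedCentroid R) M := Submodule.finiteDimensional_of_le hMle
  let T : SymQuot R →ₗ[ExtendedCentroid R] M →ₗ[ExtendedCentroid R] M :=
    LinearMap.mk₂ _ (fun q m => ⟨q * m, (hM q m m.2).1⟩)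
      (fun q q' m => Subtype.ext (add_mul q q' (m : SymQuot R)))
      (fun c q m => Subtype.ext (smul_mul_assoc c q (m : SymQuot R)))
      (fun q m m' => Subtype.ext (mul_add q (m : SymQuot R) m'))
      (fun c q m => Subtype.ext (mul_smul_comm c q (m : SymQuot R)))
  refine Module.Finite.of_injective T ((injective_iff_map_eq_zero T).2 fun q hq => ?_)
  exact eq_zero_of_mul_ι hI fun x hx => congrArg Subtype.val
    (LinearMap.congr_fun hq ⟨ι R x, Submodule.subset_span ⟨x, hx, rfl⟩⟩)

variable (R) in
theorem isSimpleRing_of_finiteDimensional_centralClosure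
    [FiniteDimensional (ExtendedCentroid R) (centralClosure R)] : IsSimpleRing (SymQuot R) :=
  have := finiteDimensional_of_centralClosure R
  IsSimpleRing.of_forall_mul_mul (ExtendedCentroid R) eq_zero_or_eq_zero_of_forall_mul_mul

variable (R) in
-- The stable span is a nonzero ideal of a simple ring, so it contains 1, and it lies in the central
-- closure.
theorem centralClosure_eq_top [FiniteDimensional (ExtendedCentroid R) (centralClosure R)] :
    centralClosure R = ⊤ := by
  have := isSimpleRing_of_finiteDimensional_centralClosure R
  obtain ⟨I, hI, hM⟩ := exists_ideal_span_stable (R := R)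
  set M := Submodule.span (ExtendedCentroid R) (ι R '' (I : Set R))
  have hMle : M ≤ centralClosure R := Submodule.span_mono (Set.image_mono fun _ _ => trivial)
  obtain ⟨x, hx, hx0⟩ := exists_mem_ne_zero hI
  let J : TwoSidedIdeal (SymQuot R) := TwoSidedIdeal.mk' (M : Set (SymQuot R)) M.zero_mem
    M.add_mem M.neg_mem (fun {q m} hm => (hM q m hm).1) (fun {m q} hm => (hM q m hm).2)
  have hJ : ∀ q, q ∈ J ↔ q ∈ M := fun q => TwoSidedIdeal.mem_mk' _ _ _ _ _ _ _
  have h1 : (1 : SymQuot R) ∈ M := (hJ 1).1 (IsSimpleRing.one_mem_of_ne_zero_mem (x := ι R x) J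
    (fun h => hx0 (ι_injective (h.trans (map_zero _).symm)))
    ((hJ _).2 (Submodule.subset_span ⟨x, hx, rfl⟩)))
  exact Submodule.eq_top_iff'.2 fun q => hMle (by simpa using (hM q 1 h1).1)

end Martindale.SymQuot


/-! ### Exceptional rings inside 2 × 2 matrices. -/

namespace IsExceptional

variable {R : Type*} [NonUnitalRing R] [IsPrimeRing R] [Nontrivial R]

theorem finiteDimensional (hR : IsExceptional R) :
    FiniteDimensional (ExtendedCentroid R) (centralClosure R) :=
  Module.finite_of_rank_eq_nat (n := 4) (by exact_mod_cast hR.rank_eq)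

theorem centralClosure_eq_top (hR : IsExceptional R) : centralClosure R = ⊤ :=
  have := hR.finiteDimensional
  SymQuot.centralClosure_eq_top R

theorem finrank_symQuot (hR : IsExceptional R) :
    Module.finrank (ExtendedCentroid R) (SymQuot R) = 4 := by
  have h : Module.finrank (ExtendedCentroid R) (centralClosure R) = 4 :=
    Module.finrank_eq_of_rank_eq (n := 4) (by exact_mod_cast hR.rank_eq)
  rw [hR.centralClosure_eq_top, finrank_top] at h
  exact h

theorem exists_algHom_matrix (hR : IsExceptional R) : ∃ φ : SymQuot R →ₐ[ExtendedCentroid R]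
    Matrix (Fin 2) (Fin 2) (AlgebraicClosure (ExtendedCentroid R)),
    Submodule.span (AlgebraicClosure (ExtendedCentroid R)) (Set.range φ) = ⊤ :=
  have := hR.finiteDimensional
  have := SymQuot.isSimpleRing_of_finiteDimensional_centralClosure R
  exists_algHom_matrix_two _ _ hR.finrank_symQuot

end IsExceptional

/-! ### Commutators of 2 × 2 matrices in characteristic two. -/

section Matrix

open Matrix

theorem Matrix.mem_span_one_fin_two_iff {F : Type*} [CommRing F] {X : Matrix (Fin 2) (Fin 2) F} :
    X ∈ Submodule.span F {(1 : Matrix (Fin 2) (Fin 2) F)} ↔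
      X 0 0 = X 1 1 ∧ X 0 1 = 0 ∧ X 1 0 = 0 := by
  rw [Submodule.mem_span_singleton]
  constructor
  · rintro ⟨c, rfl⟩
    simp
  · rintro ⟨h, h01, h10⟩
    refine ⟨X 0 0, ?_⟩
    ext i j
    fin_cases i <;> fin_cases j <;> simp [h, h01, h10]

variable {F : Type*} [Field F]

theorem Matrix.mem_span_one_of_forall_comm_mem {A : Matrix (Fin 2) (Fin 2) F}
    (h : ∀ Y, A * Y - Y * A ∈ Submodule.span F {(1 : Matrix (Fin 2) (Fin 2) F)}) :
    A ∈ Submodule.span F {(1 : Matrix (Fin 2) (Fin 2) F)} := by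
  -- The commutator with `E₁₁` exhibits the off-diagonal entries of `A`, that with `E₁₂` the
  -- difference of the diagonal ones.
  have h0 := mem_span_one_fin_two_iff.1 (h !![1, 0; 0, 0])
  have h1 := mem_span_one_fin_two_iff.1 (h !![0, 1; 0, 0])
  simp only [sub_apply, mul_apply, Fin.sum_univ_two, of_apply, cons_val', cons_val_zero,
    cons_val_one, cons_val_fin_one] at h0 h1
  refine mem_span_one_fin_two_iff.2 ⟨?_, ?_, ?_⟩
  · linear_combination h1.2.1
  · linear_combination -h0.2.1
  · linear_combination h0.2.2

/-- Polarized Cayley–Hamilton reads `AX + XA = tr(A) X + tr(X) A + scalar`; here `tr X = 0` and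
signs do not matter. -/
theorem Matrix.comm_sub_trace_smul_mem (h2 : (2 : F) = 0) (A : Matrix (Fin 2) (Fin 2) F)
    {X : Matrix (Fin 2) (Fin 2) F} (hX : X.trace = 0) :
    A * X - X * A - A.trace • X ∈ Submodule.span F {(1 : Matrix (Fin 2) (Fin 2) F)} := by
  rw [trace_fin_two] at hX
  rw [mem_span_one_fin_two_iff]
  simp only [sub_apply, smul_apply, mul_apply, Fin.sum_univ_two, trace_fin_two, smul_eq_mul]
  refine ⟨?_, ?_, ?_⟩
  · linear_combination (A 0 1 * X 1 0 - X 0 1 * A 1 0 - (A 0 0 + A 1 1) * X 0 0) * h2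
      + (A 0 0 + A 1 1) * hX
  · linear_combination (-A 0 1 * X 0 0 - A 1 1 * X 0 1) * h2 + A 0 1 * hX
  · linear_combination (A 1 0 * X 0 0 - A 0 0 * X 1 0) * h2 - A 1 0 * hX

/-- In characteristic two `(ad A)² = ad (A²) = tr(A) ad A`, and its value at `E₁₂` has upper right
entry `tr(A)²`. -/
theorem Matrix.trace_eq_zero_of_forall_comm_comm (h2 : (2 : F) = 0)
    {A : Matrix (Fin 2) (Fin 2) F}
    (h : ∀ Y, A * (A * Y - Y * A) - (A * Y - Y * A) * A = 0) : A.trace = 0 := by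
  have h1 := congrFun (congrFun (h !![0, 1; 0, 0]) 0) 1
  simp only [sub_apply, mul_apply, Fin.sum_univ_two, of_apply, cons_val', cons_val_zero,
    cons_val_one, cons_val_fin_one, zero_apply] at h1
  rw [trace_fin_two]
  refine pow_eq_zero_iff (two_ne_zero) |>.1 ?_
  linear_combination h1 + (2 * A 0 0 * A 1 1 - A 0 1 * A 1 0) * h2

theorem Matrix.finrank_ker_trace_fin_two :
    Module.finrank F (LinearMap.ker (traceLinearMap (Fin 2) F F)) = 3 := by
  have h := LinearMap.finrank_range_add_finrank_ker (traceLinearMap (Fin 2) F F)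
  have hr : LinearMap.range (traceLinearMap (Fin 2) F F) = ⊤ :=
    LinearMap.range_eq_top.2 fun c => ⟨!![c, 0; 0, 0], by simp [trace_fin_two]⟩
  rw [hr, finrank_top, Module.finrank_self, Module.finrank_matrix] at h
  simp at h
  omega

/-- `E₁₂`, `E₂₁` and `E₁₁ - E₂₂` are commutators of matrix units. -/
theorem Matrix.ker_trace_fin_two_le {N : Submodule F (Matrix (Fin 2) (Fin 2) F)}
    (h : ∀ X Y : Matrix (Fin 2) (Fin 2) F, X * Y - Y * X ∈ N) :
    LinearMap.ker (traceLinearMap (Fin 2) F F) ≤ N := by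
  intro X hX
  rw [LinearMap.mem_ker, traceLinearMap_apply, trace_fin_two] at hX
  have h01 := h !![X 0 1, 0; 0, 0] !![0, 1; 0, 0]
  have h10 := h !![0, 0; 0, X 1 0] !![0, 0; 1, 0]
  have hd := h !![0, X 0 0; 0, 0] !![0, 0; 1, 0]
  have : X = (!![X 0 1, 0; 0, 0] * !![0, 1; 0, 0] - !![0, 1; 0, 0] * !![X 0 1, 0; 0, 0])
      + (!![0, 0; 0, X 1 0] * !![0, 0; 1, 0] - !![0, 0; 1, 0] * !![0, 0; 0, X 1 0])
      + (!![0, X 0 0; 0, 0] * !![0, 0; 1, 0] - !![0, 0; 1, 0] * !![0, X 0 0; 0, 0]) := by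
    ext i j
    fin_cases i <;> fin_cases j <;> simp [eq_neg_of_add_eq_zero_right hX]
  rw [this]
  exact N.add_mem (N.add_mem h01 h10) hd

theorem iterComm_cons {R : Type*} [NonUnitalRing R] (b : R) (l : List R) (x : R) :
    iterComm (b :: l) x = b * iterComm l x - iterComm l x * b := rfl

theorem iterComm_append {R : Type*} [NonUnitalRing R] (l l' : List R) (x : R) :
    iterComm (l ++ l') x = iterComm l (iterComm l' x) := List.foldr_append

theorem map_iterComm {R S : Type*} [NonUnitalRing R] [NonUnitalRing S] (f : R →ₙ+* S)
    (l : List R) (x : R) : f (iterComm l x) = iterComm (l.map f) (f x) := by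
  induction l with
  | nil => rfl
  | cons b l ih => rw [iterComm_cons, map_sub, map_mul, map_mul, ih, List.map_cons, iterComm_cons]

/-- Each commutator multiplies by a trace up to a scalar matrix, and that error commutes with
everything that follows. -/
theorem Matrix.iterComm_sub_prod_smul_mem (h2 : (2 : F) = 0)
    (l : List (Matrix (Fin 2) (Fin 2) F)) {X : Matrix (Fin 2) (Fin 2) F} (hX : X.trace = 0) :
    iterComm l X - (l.map trace).prod • X ∈
      Submodule.span F {(1 : Matrix (Fin 2) (Fin 2) F)} := by
  induction l with
  | nil => simp [iterComm]
  | cons A l ih =>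
    obtain ⟨c, hc⟩ := Submodule.mem_span_singleton.1 ih
    have h := Submodule.smul_mem _ (l.map trace).prod (comm_sub_trace_smul_mem h2 A hX)
    rw [iterComm_cons, eq_add_of_sub_eq hc.symm, List.map_cons, List.prod_cons]
    convert h using 1
    simp only [mul_add, add_mul, mul_smul_comm, smul_mul_assoc, mul_one, one_mul, smul_sub,
      mul_smul, smul_comm A.trace]
    abel

theorem Matrix.iterComm_mem_span_one_iff (h2 : (2 : F) = 0)
    (l : List (Matrix (Fin 2) (Fin 2) F)) {X : Matrix (Fin 2) (Fin 2) F} (hX : X.trace = 0) :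
    iterComm l X ∈ Submodule.span F {(1 : Matrix (Fin 2) (Fin 2) F)} ↔
      (∃ A ∈ l, A.trace = 0) ∨ X ∈ Submodule.span F {(1 : Matrix (Fin 2) (Fin 2) F)} := by
  have h := iterComm_sub_prod_smul_mem h2 l hX
  have h0 : (l.map trace).prod = 0 ↔ ∃ A ∈ l, A.trace = 0 := by
    rw [List.prod_eq_zero_iff, List.mem_map]
  have h1 : iterComm l X ∈ Submodule.span F {(1 : Matrix (Fin 2) (Fin 2) F)} ↔
      (l.map trace).prod • X ∈ Submodule.span F {(1 : Matrix (Fin 2) (Fin 2) F)} :=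
    ⟨fun k => by simpa using Submodule.sub_mem _ k h,
      fun k => by simpa using Submodule.add_mem _ h k⟩
  rw [← h0, h1]
  by_cases hp : (l.map trace).prod = 0
  · simp [hp]
  · rw [Submodule.smul_mem_iff _ hp]
    simp [hp]

end Matrix

/-! ### Trace zero and sums of commutators. -/

section CentralSimple

variable {K B F : Type*} [Field K] [Ring B] [Algebra K B] [Field F] [Algebra K F]

theorem AlgHom.span_image_eq_top_of_span_eq_top
    {φ : B →ₐ[K] Matrix (Fin 2) (Fin 2) F} (hφ : Submodule.span F (Set.range φ) = ⊤)
    {s : Set B} (hs : Submodule.span K s = ⊤) : Submodule.span F (φ '' s) = ⊤ := by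
  refine top_unique (hφ ▸ Submodule.span_le.2 ?_)
  rintro _ ⟨q, rfl⟩
  have hq : q ∈ Submodule.span K s := hs ▸ Submodule.mem_top
  induction hq using Submodule.span_induction with
  | mem q hq => exact Submodule.subset_span ⟨q, hq, rfl⟩
  | zero => simp
  | add q q' _ _ h h' => rw [map_add]; exact Submodule.add_mem _ h h'
  | smul c q _ h =>
    rw [map_smul, ← algebraMap_smul F c (φ q)]
    exact Submodule.smul_mem _ _ h

/-- In a split four-dimensional central simple algebra the elements of trace zero are spanned by
commutators. -/
theorem AlgHom.mem_span_comm_of_trace_eq_zero (h4 : Module.finrank K B = 4)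
    {φ : B →ₐ[K] Matrix (Fin 2) (Fin 2) F} (hφ : Submodule.span F (Set.range φ) = ⊤)
    {q : B} (hq : (φ q).trace = 0) :
    q ∈ Submodule.span K {z : B | ∃ x y, z = x * y - y * x} := by
  have : FiniteDimensional K B := FiniteDimensional.of_finrank_pos (by omega)
  set W := Submodule.span K {z : B | ∃ x y, z = x * y - y * x}
  let V : Submodule K B := LinearMap.ker
    ((Matrix.traceLinearMap (Fin 2) F F).restrictScalars K ∘ₗ φ.toLinearMap)
  have hV : ∀ x, x ∈ V ↔ (φ x).trace = 0 := fun x => Iff.rfl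
  have hWV : W ≤ V := Submodule.span_le.2 (by
    rintro _ ⟨x, y, rfl⟩
    rw [SetLike.mem_coe, hV, map_sub, map_mul, map_mul, Matrix.trace_sub, Matrix.trace_mul_comm,
      sub_self])
  -- The inclusion `W ≤ V` is an equality by dimension: `V` is proper, and `W` has dimension at
  -- least three because the `F`-span of its image contains all commutators, hence all matrices of
  -- trace zero.
  have hVtop : V ≠ ⊤ := fun h => by
    have : (⊤ : Submodule F (Matrix (Fin 2) (Fin 2) F)) ≤
        LinearMap.ker (Matrix.traceLinearMap (Fin 2) F F) := by
      rw [← hφ, Submodule.span_le]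
      rintro _ ⟨x, rfl⟩
      exact (hV x).1 (h ▸ Submodule.mem_top)
    have h1 := this (Submodule.mem_top (x := !![1, 0; 0, 0]))
    simp [Matrix.trace_fin_two] at h1
  have hV3 : Module.finrank K V ≤ 3 := by
    have := Submodule.finrank_lt hVtop
    omega
  have hW3 : 3 ≤ Module.finrank K W := by
    let b := Module.finBasis K W
    have hspan : ∀ x ∈ W, φ x ∈ Submodule.span F (Set.range fun i => φ (b i)) := fun x hx => by
      have hx' : x = ∑ i, b.repr ⟨x, hx⟩ i • (b i : B) := by
        have := congrArg W.subtype (b.sum_repr ⟨x, hx⟩)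
        rw [map_sum] at this
        exact this.symm
      rw [hx', map_sum]
      refine Submodule.sum_mem _ fun i _ => ?_
      rw [map_smul, ← algebraMap_smul F]
      exact Submodule.smul_mem _ _ (Submodule.subset_span ⟨i, rfl⟩)
    have hcomm : ∀ X Y : Matrix (Fin 2) (Fin 2) F,
        X * Y - Y * X ∈ Submodule.span F (Set.range fun i => φ (b i)) := fun X Y => by
      have hX : X ∈ Submodule.span F (Set.range φ) := hφ ▸ Submodule.mem_top
      have hY : Y ∈ Submodule.span F (Set.range φ) := hφ ▸ Submodule.mem_top
      induction hX, hY using Submodule.span_induction₂ with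
      | mem_mem X Y hX hY =>
        obtain ⟨x, rfl⟩ := hX
        obtain ⟨y, rfl⟩ := hY
        rw [← map_mul, ← map_mul, ← map_sub]
        exact hspan _ (Submodule.subset_span ⟨x, y, rfl⟩)
      | zero_left Y hY => simp
      | zero_right X hX => simp
      | add_left X X' Y _ _ _ h h' =>
        rw [add_mul, mul_add, add_sub_add_comm]; exact Submodule.add_mem _ h h'
      | add_right X Y Y' _ _ _ h h' =>
        rw [add_mul, mul_add, add_sub_add_comm]; exact Submodule.add_mem _ h h'
      | smul_left c X Y _ _ h =>
        rw [smul_mul_assoc, mul_smul_comm, ← smul_sub]; exact Submodule.smul_mem _ _ h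
      | smul_right c X Y _ _ h =>
        rw [smul_mul_assoc, mul_smul_comm, ← smul_sub]; exact Submodule.smul_mem _ _ h
    calc 3 = Module.finrank F (LinearMap.ker (Matrix.traceLinearMap (Fin 2) F F)) :=
          Matrix.finrank_ker_trace_fin_two.symm
      _ ≤ Module.finrank F (Submodule.span F (Set.range fun i => φ (b i))) :=
          Submodule.finrank_mono (Matrix.ker_trace_fin_two_le hcomm)
      _ ≤ Module.finrank K W := (finrank_range_le_card _).trans (by simp)
  rw [Submodule.eq_of_le_of_finrank_le hWV (hV3.trans hW3)]
  exact (hV q).2 hq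

end CentralSimple

/-! ### The matrix embedding of an exceptional ring and the theorem. -/

section Exceptional

variable {R : Type*} [NonUnitalRing R] [IsPrimeRing R] [Nontrivial R]

/-- The additive group `[RC, RC]` is already a `C`-subspace, since `c [x, y] = [c x, y]`. -/
theorem span_comm_le_commCentralClosure (h : centralClosure R = ⊤) {q : SymQuot R}
    (hq : q ∈ Submodule.span (ExtendedCentroid R) {z : SymQuot R | ∃ x y, z = x * y - y * x}) :
    q ∈ commCentralClosure R := by
  have hmem : ∀ x : SymQuot R, x ∈ centralClosure R := fun x => h ▸ Submodule.mem_top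
  induction hq using Submodule.span_induction with
  | mem z hz =>
    obtain ⟨x, y, rfl⟩ := hz
    exact AddSubgroup.subset_closure ⟨x, hmem x, y, hmem y, rfl⟩
  | zero => exact zero_mem _
  | add z z' _ _ hz hz' => exact add_mem hz hz'
  | smul c z hz' hz =>
    clear hz'
    induction hz using AddSubgroup.closure_induction with
    | mem z hz =>
      obtain ⟨x, -, y, -, rfl⟩ := hz
      refine AddSubgroup.subset_closure ⟨c • x, hmem _, y, hmem y, ?_⟩
      rw [smul_sub, smul_mul_assoc, mul_smul_comm]
    | zero => rw [smul_zero]; exact zero_mem _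
    | add z z' _ _ hz hz' => rw [smul_add]; exact add_mem hz hz'
    | neg z _ hz => rw [smul_neg]; exact neg_mem hz

theorem trace_eq_zero_of_mem_commCentralClosure {F : Type*} [Field F]
    [Algebra (ExtendedCentroid R) F]
    (φ : SymQuot R →ₐ[ExtendedCentroid R] Matrix (Fin 2) (Fin 2) F)
    {q : SymQuot R} (hq : q ∈ commCentralClosure R) : (φ q).trace = 0 := by
  induction hq using AddSubgroup.closure_induction with
  | mem z hz =>
    obtain ⟨x, -, y, -, rfl⟩ := hz
    rw [map_sub, map_mul, map_mul, Matrix.trace_sub, Matrix.trace_mul_comm, sub_self]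
  | zero => simp
  | add z z' _ _ hz hz' => rw [map_add, Matrix.trace_add, hz, hz', add_zero]
  | neg z _ hz => rw [map_neg, Matrix.trace_neg, hz, neg_zero]

theorem IsExceptional.two_nsmul_symQuot (hR : IsExceptional R) (q : SymQuot R) : 2 • q = 0 := by
  have hq : q ∈ centralClosure R := hR.centralClosure_eq_top ▸ Submodule.mem_top
  induction hq using Submodule.span_induction with
  | mem z hz =>
    obtain ⟨x, -, rfl⟩ := hz
    rw [← map_nsmul, hR.char_two, map_zero]
  | zero => simp
  | add z z' _ _ hz hz' => rw [nsmul_add, hz, hz', add_zero]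
  | smul c z _ hz => rw [smul_comm, hz, smul_zero]

/-- An exceptional prime ring embeds in `2 × 2` matrices over a field of characteristic two in such
a way that central elements are the scalar ones and the elements of `[R C, R C]` are those of trace
zero. -/
theorem IsExceptional.exists_matrix_embedding.{u} {R : Type u} [NonUnitalRing R] [IsPrimeRing R]
    [Nontrivial R] (hR : IsExceptional R) :
    ∃ (F : Type u) (_ : Field F) (ψ : R →ₙ+* Matrix (Fin 2) (Fin 2) F), (2 : F) = 0 ∧
      (∀ L : AddSubgroup R, extC L = centralClosure R → Submodule.span F (ψ '' L) = ⊤) ∧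
      (∀ x, x ∈ Set.center R ↔
        ψ x ∈ Submodule.span F {(1 : Matrix (Fin 2) (Fin 2) F)}) ∧
      ∀ x, SymQuot.ι R x ∈ commCentralClosure R ↔ (ψ x).trace = 0 := by
  have hfin := hR.finiteDimensional
  have := SymQuot.isSimpleRing_of_finiteDimensional_centralClosure R
  obtain ⟨φ, hφ⟩ := hR.exists_algHom_matrix
  let F := AlgebraicClosure (ExtendedCentroid R)
  let ψ : R →ₙ+* Matrix (Fin 2) (Fin 2) F := (φ : SymQuot R →ₙ+* _).comp (SymQuot.ι R)
  have hψ : ∀ x, ψ x = φ (SymQuot.ι R x) := fun _ => rfl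
  have hspan : ∀ L : AddSubgroup R, extC L = centralClosure R →
      Submodule.span F (ψ '' L) = ⊤ := fun L hL => by
    have := AlgHom.span_image_eq_top_of_span_eq_top hφ (hL.trans hR.centralClosure_eq_top)
    rwa [← Set.image_comp] at this
  have hinj : Function.Injective ψ :=
    (RingHom.injective (φ : SymQuot R →+* Matrix (Fin 2) (Fin 2) F)).comp SymQuot.ι_injective
  refine ⟨F, inferInstance, ψ, ?_, hspan, fun x => ⟨fun hx => ?_, fun hx => ?_⟩, fun x =>
    ⟨fun hx => trace_eq_zero_of_mem_commCentralClosure φ hx, fun hx =>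
      span_comm_le_commCentralClosure hR.centralClosure_eq_top
        (AlgHom.mem_span_comm_of_trace_eq_zero hR.finrank_symQuot hφ hx)⟩⟩
  · have h := congrArg φ (hR.two_nsmul_symQuot 1)
    rw [map_nsmul, map_one, map_zero] at h
    have h1 := congrFun (congrFun h 0) 0
    simpa using h1
  · refine Matrix.mem_span_one_of_forall_comm_mem fun Y => ?_
    -- Commuting with `Y` is a linear condition on `Y`, so it passes from the image of `R` to its
    -- span, which is everything.
    have hle : Submodule.span F (ψ '' (⊤ : AddSubgroup R)) ≤
        LinearMap.ker (LinearMap.mulLeft F (ψ x) - LinearMap.mulRight F (ψ x)) := by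
      rw [Submodule.span_le]
      rintro _ ⟨r, -, rfl⟩
      change ψ x * ψ r - ψ r * ψ x = 0
      rw [← map_mul, ← map_mul, Semigroup.mem_center_iff.1 hx r, sub_self]
    have hY : ψ x * Y - Y * ψ x = 0 := hle (hspan ⊤ rfl ▸ Submodule.mem_top : Y ∈ _)
    rw [hY]
    exact zero_mem _
  · obtain ⟨c, hc⟩ := Submodule.mem_span_singleton.1 hx
    refine Semigroup.mem_center_iff.2 fun r => hinj ?_
    rw [map_mul, map_mul, ← hc]
    simp

end Exceptional

theorem theorem5 {R : Type*} [NonUnitalRing R] [IsPrimeRing R] [Nontrivial R]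
    (hR : IsExceptional R) (L : AddSubgroup R) (hL : IsLieIdeal L)
    (hLZ : ¬ (L : Set R) ⊆ Set.center R) (n : ℕ) (a : Fin (n + 1) → R) :
    ((IsAbelian L ∨ IsTypeI L) →
      ((∀ x ∈ L, iterComm (List.ofFn a) x ∈ Set.center R) ↔
        ∃ i : Fin (n + 1), SymQuot.ι R (a i) ∈ commCentralClosure R)) ∧
    (IsTypeII L →
      ((∀ x ∈ L, iterComm (List.ofFn a) x ∈ Set.center R) ↔
        a (Fin.last n) ∈ Set.center R ∨
          ∃ i : Fin n, SymQuot.ι R (a i.castSucc) ∈ commCentralClosure R)) := by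
  obtain ⟨F, _, ψ, h2, hspan, hcenter, htrace⟩ := hR.exists_matrix_embedding
  have hiter : ∀ (l : List R) (x : R), (ψ x).trace = 0 → (iterComm l x ∈ Set.center R ↔
      (∃ b ∈ l, SymQuot.ι R b ∈ commCentralClosure R) ∨ x ∈ Set.center R) := fun l x hx => by
    rw [hcenter, map_iterComm, Matrix.iterComm_mem_span_one_iff h2 _ hx, ← hcenter]
    simp [htrace]
  constructor
  · intro hab
    have hL0 : ∀ x ∈ L, (ψ x).trace = 0 := fun x hx => by
      rcases hab with hab | hI
      -- For abelian `L`, both `x` and `[x, r]` lie in `L`, so `[x, [x, r]] = 0`; this is linear in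
      -- `r` and extends to all matrices.
      · refine Matrix.trace_eq_zero_of_forall_comm_comm h2 fun Y => ?_
        have hle : Submodule.span F (ψ '' (⊤ : AddSubgroup R)) ≤ LinearMap.ker
            ((LinearMap.mulLeft F (ψ x) - LinearMap.mulRight F (ψ x)) ∘ₗ
              (LinearMap.mulLeft F (ψ x) - LinearMap.mulRight F (ψ x))) := by
          rw [Submodule.span_le]
          rintro _ ⟨r, -, rfl⟩
          change ψ x * (ψ x * ψ r - ψ r * ψ x) - (ψ x * ψ r - ψ r * ψ x) * ψ x = 0
          simp only [← map_mul, ← map_sub]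
          rw [hab x hx _ (hL x hx r), map_zero]
        exact hle (hspan ⊤ rfl ▸ Submodule.mem_top : Y ∈ _)
      · rw [← htrace, ← hI.2]
        exact Submodule.subset_span ⟨x, hx, rfl⟩
    obtain ⟨x, hx, hxZ⟩ := Set.not_subset.1 hLZ
    constructor
    · intro h
      obtain ⟨b, hb, hb0⟩ := ((hiter _ x (hL0 x hx)).1 (h x hx)).resolve_right hxZ
      obtain ⟨i, rfl⟩ := List.mem_ofFn.1 hb
      exact ⟨i, hb0⟩
    · rintro ⟨i, hi⟩ y hy
      exact (hiter _ y (hL0 y hy)).2 (Or.inl ⟨a i, List.mem_ofFn.2 ⟨i, rfl⟩, hi⟩)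
  · intro hII
    set b := a (Fin.last n)
    -- The last entry acts first. Splitting it off leaves an iterated commutator applied to `[b,
    -- x]`, which has trace zero even when `x` does not.
    have hofFn : ∀ x, iterComm (List.ofFn a) x =
        iterComm (List.ofFn fun i : Fin n => a i.castSucc) (b * x - x * b) := fun x => by
      rw [List.ofFn_succ', List.concat_eq_append, iterComm_append]
      rfl
    have htr : ∀ x, (ψ (b * x - x * b)).trace = 0 := fun x => by
      rw [map_sub, map_mul, map_mul, Matrix.trace_sub, Matrix.trace_mul_comm, sub_self]
    simp only [hofFn, hiter _ _ (htr _), List.mem_ofFn', Set.mem_range, exists_exists_eq_and]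
    constructor
    · intro h
      by_contra! H
      refine H.1 ((hcenter b).2 (Matrix.mem_span_one_of_forall_comm_mem fun Y => ?_))
      -- That `[b, x]` is scalar is a linear condition on `x`, so it extends from `L` to all
      -- matrices, which makes `b` scalar.
      have hle : Submodule.span F (ψ '' L) ≤
          (Submodule.span F {(1 : Matrix (Fin 2) (Fin 2) F)}).comap
            (LinearMap.mulLeft F (ψ b) - LinearMap.mulRight F (ψ b)) := by
        rw [Submodule.span_le]
        rintro _ ⟨x, hx, rfl⟩
        change ψ b * ψ x - ψ x * ψ b ∈ Submodule.span F {(1 : Matrix (Fin 2) (Fin 2) F)}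
        rw [← map_mul, ← map_mul, ← map_sub, ← hcenter]
        exact (h x hx).resolve_left fun ⟨i, hi⟩ => H.2 i hi
      have hY : Y ∈ Submodule.span F (ψ '' L) := hspan L hII.2 ▸ Submodule.mem_top
      exact hle hY
    · rintro (hb | hi) x hx
      · right
        rw [Semigroup.mem_center_iff.1 hb x, sub_self]
        exact Set.zero_mem_center
      · exact Or.inl hi
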